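/- For a finite field $\mathbb F_q$ with $q$ elements, positive integers $m, k$ and $b\in\mathbb F_q$, let $N_m^*(k,b)$ denote the number of $k$-tuples $(x_1,\dots,x_k)$ of pairwise distinct nonzero elements of $\mathbb F_q$ such that $$x_1^m+x_2^m+\cdots+x_k^m=b.$$ There is an effectively computable absolute constant $0<c<1$ with the following property. Let $\mathbb F_q$ be any finite field of characteristic $p>2$ and let $m,k$ be positive integers. If $$m<c\sqrt q \quad\text{and}\quad 6\ln q<k\le \frac{q-1}{2},$$ then $N_m^*(k,b)>0$ for all $b\in\mathbb F_q$; that is, the equation $x_1^m+\cdots+x_k^m=b$ has a solution with pairwise distinct nonzero coordinates in $\mathbb F_q$. -/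

import Mathlib

/-- A real number `x` is (effectively) computable if some Turing-computable sequence of rationals
`a n / (d n + 1)`, given by integer numerators and natural-number denominators, approximates `x`
with error at most `2⁻ⁿ` at stage `n`. -/
def IsEffectivelyComputable (x : ℝ) : Prop :=
  ∃ (a : ℕ → ℤ) (d : ℕ → ℕ), Computable a ∧ Computable d ∧
    ∀ n : ℕ, |x - (a n : ℝ) / ((d n : ℝ) + 1)| ≤ (1 / 2 : ℝ) ^ n

/-- The set of ordered solutions `(x₁, …, x_k)` of `x₁ ^ m + ⋯ + x_k ^ m = b` whose coordinates are
nonzero and pairwise distinct elements of `F`. -/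
def distinctDiagonalSolutions (F : Type*) [Field F] (m k : ℕ) (b : F) : Set (Fin k → F) :=
  {x | (∀ i, x i ≠ 0) ∧ (∀ i j, i ≠ j → x i ≠ x j) ∧ ∑ i, x i ^ m = b}

/-- `N_m^*(k, b)`: the number of solutions of `x₁ ^ m + ⋯ + x_k ^ m = b` with distinct nonzero
coordinates. For a finite field `F` this is the cardinality of a finite set. -/
noncomputable def Nstar (F : Type*) [Field F] (m k : ℕ) (b : F) : ℕ :=
  (distinctDiagonalSolutions F m k b).ncard

/-! Let `n = q - 1`. By orthogonality of additive characters, `q` times the number of `k`-sets of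
units with `m`-th powers summing to `b` is `∑ₐ ψ(-ab) eₐ`, where `eₐ` is the `k`-th elementary
symmetric function of the values `ψ(a x ^ m)`. The term `a = 0` is `n.choose k`. For `a ≠ 0` the
`i`-th power sum of these values is at most `m√q` if `p ∤ i` (`norm_unitPowSum_le`), and trivially
at most `n` otherwise. Since `p ≥ 3`, Newton's identities charge at most a third of `n` for the bad
`i`, so `norm_sum_prod_powersetCard_le` bounds `eₐ` by a coefficient of `(1 - t) ^ (-M)` with `M =
n/100 + n/3`. For `k ≤ n/2` this is at most `R ^ k * n.choose k` with `R = 5/6 + 1/100 < exp(-1/6)`,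
and `k > 6 ln q` beats the `n` nontrivial characters. -/

open Finset

/-- At most `m` units of a field have the same `m`-th power. -/
lemma card_units_pow_eq_le {F : Type*} [Field F] [Fintype F] [DecidableEq F] {m : ℕ} (hm : 0 < m)
    (u : F) : #{x : Fˣ | (x : F) ^ m = u} ≤ m := by
  calc #{x : Fˣ | (x : F) ^ m = u}
      ≤ #(Polynomial.nthRoots m u).toFinset := by
        refine Finset.card_le_card_of_injOn (fun x : Fˣ => (x : F)) ?_ ?_
        · intro x hx
          simpa [Polynomial.mem_nthRoots hm] using hx
        · intro x _ y _ h
          exact Units.ext h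
    _ ≤ Multiset.card (Polynomial.nthRoots m u) := Multiset.toFinset_card_le _
    _ ≤ m := Polynomial.card_nthRoots m u

/-- The sum of `ψ (a * x ^ m)` over the units `x`. -/
noncomputable def unitPowSum {F : Type*} [Field F] [Fintype F] [DecidableEq F]
    (ψ : AddChar F ℂ) (m : ℕ) (a : F) : ℂ := ∑ x : Fˣ, ψ (a * (x : F) ^ m)

section unitPowSum

variable {F : Type*} [Field F] [Fintype F] [DecidableEq F]

lemma unitPowSum_mul_pow (ψ : AddChar F ℂ) (m : ℕ) (a : F) (y : Fˣ) :
    unitPowSum ψ m (a * (y : F) ^ m) = unitPowSum ψ m a := by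
  unfold unitPowSum
  refine Fintype.sum_equiv (Equiv.mulLeft y) _ _ fun x => ?_
  simp [mul_pow, mul_assoc]

/-- Parseval: the second moment is `q` times the number of pairs of units with equal `m`-th powers.
-/
lemma sum_norm_sq_unitPowSum {ψ : AddChar F ℂ} (hψ : ψ.IsPrimitive) {m : ℕ} (hm : 0 < m) :
    ∑ b : F, ‖unitPowSum ψ m b‖ ^ 2 ≤ (Fintype.card Fˣ : ℝ) * (m * Fintype.card F) := by
  have key : ((∑ b : F, ‖unitPowSum ψ m b‖ ^ 2 : ℝ) : ℂ)
      = ((∑ y : Fˣ, #{x : Fˣ | (x : F) ^ m = (y : F) ^ m} * Fintype.card F : ℕ) : ℂ) := by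
    have h1 : ∀ b : F, ((‖unitPowSum ψ m b‖ ^ 2 : ℝ) : ℂ)
        = ∑ y : Fˣ, ∑ x : Fˣ, ψ (b * ((x : F) ^ m - (y : F) ^ m)) := by
      intro b
      have : ((‖unitPowSum ψ m b‖ ^ 2 : ℝ) : ℂ)
          = unitPowSum ψ m b * (starRingEnd ℂ) (unitPowSum ψ m b) := by
        rw [Complex.mul_conj']
        push_cast
        rfl
      rw [this, unitPowSum, map_sum, Finset.sum_mul_sum, Finset.sum_comm]
      refine Finset.sum_congr rfl fun y _ => Finset.sum_congr rfl fun x _ => ?_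
      rw [← AddChar.map_neg_eq_conj, ← AddChar.map_add_eq_mul]
      congr 1
      ring
    push_cast
    simp only [Complex.ofReal_pow] at h1
    rw [Finset.sum_congr rfl fun b _ => h1 b, Finset.sum_comm]
    refine Finset.sum_congr rfl fun y _ => ?_
    rw [Finset.sum_comm]
    simp only [AddChar.sum_mulShift _ hψ, sub_eq_zero]
    rw [← Nat.cast_mul, ← Nat.cast_sum]
    simp [Finset.sum_ite]
  rw [← Complex.ofReal_natCast] at key
  rw [Complex.ofReal_injective key]
  norm_cast
  refine (Finset.sum_le_card_nsmul _ _ (m * Fintype.card F) fun y _ =>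
    Nat.mul_le_mul_right _ ?_).trans_eq (by simp)
  simpa only [Units.ext_iff, Units.val_pow_eq_pow_val] using card_units_pow_eq_le hm ((y : F) ^ m)

/-- The Weil bound for monomials, by averaging over the orbit of `a` under `m`-th powers. -/
lemma norm_unitPowSum_le {ψ : AddChar F ℂ} (hψ : ψ.IsPrimitive) {m : ℕ} (hm : 0 < m)
    {a : F} (ha : a ≠ 0) : ‖unitPowSum ψ m a‖ ≤ m * √(Fintype.card F) := by
  have h1 : (Fintype.card Fˣ : ℝ) * ‖unitPowSum ψ m a‖ ^ 2
      ≤ m * ∑ b : F, ‖unitPowSum ψ m b‖ ^ 2 := by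
    calc (Fintype.card Fˣ : ℝ) * ‖unitPowSum ψ m a‖ ^ 2
        = ∑ y : Fˣ, ‖unitPowSum ψ m (a * (y : F) ^ m)‖ ^ 2 := by
          simp [unitPowSum_mul_pow]
      _ = ∑ b : F, ∑ y ∈ ({y : Fˣ | a * (y : F) ^ m = b} : Finset Fˣ),
            ‖unitPowSum ψ m (a * (y : F) ^ m)‖ ^ 2 := by
          rw [Finset.sum_fiberwise]
      _ ≤ ∑ b : F, m * ‖unitPowSum ψ m b‖ ^ 2 := by
          refine Finset.sum_le_sum fun b _ => ?_
          rw [Finset.sum_congr rfl (g := fun _ => ‖unitPowSum ψ m b‖ ^ 2)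
            (fun y hy => by rw [(Finset.mem_filter.1 hy).2]), Finset.sum_const, nsmul_eq_mul]
          refine mul_le_mul_of_nonneg_right ?_ (by positivity)
          have h2 : ∀ y : Fˣ, a * (y : F) ^ m = b ↔ (y : F) ^ m = b / a := fun y => by
            rw [eq_div_iff ha, mul_comm]
          simp only [h2]
          exact_mod_cast card_units_pow_eq_le hm _
      _ = _ := by rw [Finset.mul_sum]
  have h2 := sum_norm_sq_unitPowSum hψ hm
  have h3 : (0 : ℝ) < Fintype.card Fˣ := by exact_mod_cast Fintype.card_pos
  have h4 : ‖unitPowSum ψ m a‖ ^ 2 ≤ m * (m * Fintype.card F) := by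
    refine le_of_mul_le_mul_left ?_ h3
    calc _ ≤ _ := h1
      _ ≤ m * ((Fintype.card Fˣ : ℝ) * (m * Fintype.card F)) := by gcongr
      _ = _ := by ring
  refine le_of_sq_le_sq ?_ (by positivity)
  rw [mul_pow, Real.sq_sqrt (by positivity)]
  linarith

end unitPowSum

/-! ### Newton's identities and negative binomial coefficients -/

/-- The coefficient of `t ^ k` in `(1 - t) ^ (-M)`. -/
noncomputable def negBinomCoeff (M : ℝ) (k : ℕ) : ℝ := ∏ j ∈ range k, (M + j) / (j + 1)

lemma negBinomCoeff_nonneg {M : ℝ} (hM : 0 ≤ M) (k : ℕ) : 0 ≤ negBinomCoeff M k :=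
  Finset.prod_nonneg fun _ _ => by positivity

lemma succ_mul_negBinomCoeff_succ (M : ℝ) (k : ℕ) :
    ((k + 1 : ℕ) : ℝ) * negBinomCoeff M (k + 1) = (M + k) * negBinomCoeff M k := by
  rw [negBinomCoeff, Finset.prod_range_succ, ← negBinomCoeff]
  push_cast
  field_simp

lemma monotone_negBinomCoeff {M : ℝ} (hM : 1 ≤ M) : Monotone (negBinomCoeff M) := by
  refine monotone_nat_of_le_succ fun k => ?_
  rw [negBinomCoeff, negBinomCoeff, Finset.prod_range_succ]
  refine le_mul_of_one_le_right (negBinomCoeff_nonneg (by linarith) k) ?_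
  rw [le_div_iff₀ (by positivity)]
  linarith

/-- This is `t f' = M t f / (1 - t)` for `f = (1 - t) ^ (-M)`: Newton's recursion with every power
sum equal to `M`. -/
lemma mul_negBinomCoeff (M : ℝ) (k : ℕ) :
    (k : ℝ) * negBinomCoeff M k = M * ∑ i ∈ range k, negBinomCoeff M i := by
  induction k with
  | zero => simp
  | succ k ih =>
    rw [succ_mul_negBinomCoeff_succ, Finset.sum_range_succ, mul_add, ← ih]
    ring

/-- Moving `k` down by `p` removes a block of `p` terms in which only the lowest, hence smallest,
index is counted; it carries at most `1/p ≤ 1/3` of the block. -/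
lemma three_mul_sum_dvd_le {v : ℕ → ℝ} (hv : Monotone v) (h0 : ∀ i, 0 ≤ v i) {p : ℕ}
    (hp : 3 ≤ p) (k : ℕ) :
    3 * ∑ i ∈ range k, (if p ∣ k - i then v i else 0) ≤ ∑ i ∈ range k, v i := by
  induction k using Nat.strong_induction_on with
  | _ k ih =>
    rcases lt_or_ge k p with hk | hk
    · rw [Finset.sum_eq_zero, mul_zero]
      · exact Finset.sum_nonneg fun i _ => h0 i
      · intro i hi
        rw [Finset.mem_range] at hi
        rw [if_neg]
        intro h
        have := Nat.le_of_dvd (by omega) h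
        omega
    · obtain ⟨l, rfl⟩ := Nat.exists_eq_add_of_le' hk
      have := ih l (by omega)
      rw [Finset.sum_range_add, Finset.sum_range_add]
      have h1 : ∑ i ∈ range l, (if p ∣ l + p - i then v i else 0)
          = ∑ i ∈ range l, (if p ∣ l - i then v i else 0) := by
        refine Finset.sum_congr rfl fun i hi => ?_
        rw [Finset.mem_range] at hi
        rw [show l + p - i = (l - i) + p by omega]
        simp
      have h2 : ∑ x ∈ range p, (if p ∣ l + p - (l + x) then v (l + x) else 0) = v l := by
        rw [Finset.sum_eq_single 0]
        · simp
        · intro x hx hx0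
          rw [Finset.mem_range] at hx
          rw [if_neg]
          intro h
          have := Nat.le_of_dvd (by omega) h
          omega
        · intro h
          exact absurd (Finset.mem_range.2 (by omega)) h
      have h3 : 3 * v l ≤ ∑ x ∈ range p, v (l + x) := by
        calc 3 * v l ≤ p * v l := by
              gcongr
              · exact h0 l
              · exact_mod_cast hp
          _ = ∑ x ∈ range p, v l := by simp
          _ ≤ _ := Finset.sum_le_sum fun x _ => hv (by omega)
      rw [h1, h2]
      linarith

/-- Newton's identities bound elementary symmetric functions by the coefficients of
`(1 - t) ^ (-(B + N / 3))` when the power sums are at most `B`, except for an excess of at most `N`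
at the multiples of `p`. -/
lemma norm_sum_prod_powersetCard_le {σ : Type*} [Fintype σ] (z : σ → ℂ) {p : ℕ}
    (hp : 3 ≤ p) {B N : ℝ} (hN : 0 ≤ N) (hM : 1 ≤ B + N / 3)
    (hz : ∀ i, 0 < i → ‖∑ x, z x ^ i‖ ≤ B + if p ∣ i then N else 0) (k : ℕ) :
    ‖∑ t ∈ powersetCard k (univ : Finset σ), ∏ x ∈ t, z x‖ ≤ negBinomCoeff (B + N / 3) k := by
  classical
  set e : ℕ → ℂ := fun k => ∑ t ∈ powersetCard k (univ : Finset σ), ∏ x ∈ t, z x with he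
  have hnewton : ∀ k : ℕ, (k : ℂ) * e k = (-1) ^ (k + 1) *
      ∑ a ∈ antidiagonal k with a.1 < k, (-1) ^ a.1 * e a.1 * ∑ x, z x ^ a.2 := by
    intro k
    have := congrArg (MvPolynomial.aeval z) (MvPolynomial.mul_esymm_eq_sum σ ℂ k)
    simpa [MvPolynomial.esymm, MvPolynomial.psum, map_sum, map_prod] using this
  set v := negBinomCoeff (B + N / 3) with hv
  have hv0 : ∀ i, 0 ≤ v i := negBinomCoeff_nonneg (by linarith)
  change ‖e k‖ ≤ v k
  induction k using Nat.strong_induction_on with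
  | _ k ih =>
    rcases Nat.eq_zero_or_pos k with rfl | hk
    · simp [he, hv, negBinomCoeff]
    have hk' : (0 : ℝ) < k := by exact_mod_cast hk
    refine le_of_mul_le_mul_left ?_ hk'
    have h1 : (k : ℝ) * ‖e k‖ = ‖(k : ℂ) * e k‖ := by simp
    rw [h1, hnewton k, norm_mul, norm_pow, norm_neg, norm_one, one_pow, one_mul]
    have h2 : ∑ a ∈ antidiagonal k with a.1 < k, ((-1) ^ a.1 * e a.1 * ∑ x, z x ^ a.2 : ℂ)
        = ∑ i ∈ range k, (-1) ^ i * e i * ∑ x, z x ^ (k - i) := by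
      rw [Finset.sum_filter, Finset.Nat.sum_antidiagonal_eq_sum_range_succ_mk,
        Finset.sum_range_succ]
      simp only [lt_irrefl, if_false, add_zero]
      exact Finset.sum_congr rfl fun i hi => if_pos (Finset.mem_range.1 hi)
    rw [h2]
    calc ‖∑ i ∈ range k, (-1) ^ i * e i * ∑ x, z x ^ (k - i)‖
        ≤ ∑ i ∈ range k, v i * (B + if p ∣ k - i then N else 0) := by
          refine norm_sum_le_of_le _ fun i hi => ?_
          rw [Finset.mem_range] at hi
          rw [norm_mul, norm_mul, norm_pow, norm_neg, norm_one, one_pow, one_mul]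
          exact mul_le_mul (ih i hi) (hz _ (by omega)) (norm_nonneg _) (hv0 i)
      _ = B * ∑ i ∈ range k, v i + N * ∑ i ∈ range k, (if p ∣ k - i then v i else 0) := by
          rw [Finset.mul_sum, Finset.mul_sum, ← Finset.sum_add_distrib]
          refine Finset.sum_congr rfl fun i _ => ?_
          split_ifs <;> ring
      _ ≤ B * ∑ i ∈ range k, v i + N * ((∑ i ∈ range k, v i) / 3) := by
          have := three_mul_sum_dvd_le (monotone_negBinomCoeff hM) hv0 hp k
          gcongr
          linarith
      _ = (k : ℝ) * v k := by
          rw [hv, mul_negBinomCoeff]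
          ring

lemma cast_choose_eq_prod {n k : ℕ} (h : k ≤ n) :
    (n.choose k : ℝ) = ∏ j ∈ range k, ((n : ℝ) - j) / (j + 1) := by
  induction k with
  | zero => simp
  | succ k ih =>
    rw [Finset.prod_range_succ, ← ih (by omega)]
    have h1 := Nat.choose_succ_right_eq n k
    have h2 : ((n.choose (k + 1) * (k + 1) : ℕ) : ℝ) = (n.choose k * (n - k) : ℕ) := by rw [h1]
    push_cast [Nat.cast_sub (show k ≤ n by omega)] at h2
    rw [mul_div_assoc', ← h2]
    field_simp

lemma negBinomCoeff_le_pow_mul_choose {M R : ℝ} {n k : ℕ} (hM : 0 ≤ M) (hR : R ≤ 1)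
    (hk : k ≤ n) (h : M + k ≤ R * n) : negBinomCoeff M k ≤ R ^ k * n.choose k := by
  rw [cast_choose_eq_prod hk, negBinomCoeff, Finset.prod_div_distrib, Finset.prod_div_distrib,
    mul_div_assoc']
  have h0 : (0 : ℝ) ≤ ∏ j ∈ range k, ((j : ℝ) + 1) := Finset.prod_nonneg fun _ _ => by positivity
  refine div_le_div_of_nonneg_right ?_ h0
  -- Reversing one product pairs `M + (k - 1 - j)` with `n - j`; as `R ≤ 1`, the ratio is at most
  -- `R` factor by factor.
  rw [← Finset.prod_range_reflect (fun j : ℕ => M + (j : ℝ))]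
  calc ∏ j ∈ range k, (M + ((k - 1 - j : ℕ) : ℝ)) ≤ ∏ j ∈ range k, (R * ((n : ℝ) - j)) := by
        refine Finset.prod_le_prod (fun _ _ => by positivity) fun j hj => ?_
        rw [Finset.mem_range] at hj
        rw [Nat.sub_sub, Nat.cast_sub (by omega)]
        push_cast
        have : R * (j : ℝ) ≤ 1 * j := by gcongr
        linarith
    _ = _ := by rw [Finset.prod_mul_distrib]; simp

lemma addChar_map_sum_eq_prod {A M ι : Type*} [AddCommMonoid A] [CommMonoid M] (ψ : AddChar A M)
    (t : Finset ι) (f : ι → A) : ψ (∑ i ∈ t, f i) = ∏ i ∈ t, ψ (f i) := by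
  classical
  induction t using Finset.induction_on with
  | empty => simp
  | insert i t hi ih => rw [Finset.sum_insert hi, Finset.prod_insert hi, ψ.map_add_eq_mul, ih]

lemma effectivelyComputable_one_div_200 : IsEffectivelyComputable (1 / 200) :=
  ⟨fun _ => 1, fun _ => 199, Computable.const _, Computable.const _, fun n => by
    norm_num⟩

/-! ### Character sums and the final estimate -/

/-- If every nontrivial character contribution is small, some `k`-set of units has the prescribed
sum of `m`-th powers. -/
lemma exists_powersetCard_sum_pow_eq {F : Type*} [Field F] [Fintype F] [DecidableEq F] {p : ℕ}
    [CharP F p] (hp : 3 ≤ p) {m k : ℕ} (hm : 0 < m) {B : ℝ}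
    (hB : m * √(Fintype.card F) ≤ B) (hM : 1 ≤ B + (Fintype.card Fˣ : ℝ) / 3)
    (hlt : (Fintype.card Fˣ : ℝ) * negBinomCoeff (B + (Fintype.card Fˣ : ℝ) / 3) k
      < (Fintype.card Fˣ).choose k) (b : F) :
    ∃ t : Finset Fˣ, #t = k ∧ ∑ x ∈ t, (x : F) ^ m = b := by
  by_contra! hne
  set ψ := AddChar.FiniteField.primitiveChar_to_Complex F
  have hψ : ψ.IsPrimitive := AddChar.FiniteField.primitiveChar_to_Complex_isPrimitive F
  set e : F → ℂ := fun a => ∑ t ∈ powersetCard k (univ : Finset Fˣ), ∏ x ∈ t, ψ (a * (x : F) ^ m)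
    with he
  have hB0 : 0 ≤ B := le_trans (by positivity) hB
  have hsum : ∑ a : F, ψ (-(a * b)) * e a = 0 := by
    simp only [he, Finset.mul_sum]
    rw [Finset.sum_comm]
    refine Finset.sum_eq_zero fun t ht => ?_
    have h1 : ∀ a : F, ψ (-(a * b)) * ∏ x ∈ t, ψ (a * (x : F) ^ m)
        = ψ (a * (∑ x ∈ t, (x : F) ^ m - b)) := by
      intro a
      rw [← addChar_map_sum_eq_prod, ← AddChar.map_add_eq_mul, ← Finset.mul_sum]
      congr 1
      ring
    simp only [h1, AddChar.sum_mulShift _ hψ]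
    rw [if_neg (sub_ne_zero.2 (hne t (Finset.mem_powersetCard.1 ht).2))]
    simp
  have he0 : e 0 = ((Fintype.card Fˣ).choose k : ℂ) := by simp [he]
  have hea : ∀ a : F, a ≠ 0 → ‖e a‖ ≤ negBinomCoeff (B + (Fintype.card Fˣ : ℝ) / 3) k := by
    intro a ha
    refine norm_sum_prod_powersetCard_le (fun x : Fˣ => ψ (a * (x : F) ^ m)) hp (by positivity) hM
      (fun i _ => ?_) k
    split_ifs with hpi
    · refine (norm_sum_le_of_le (n := fun _ => (1 : ℝ)) _ fun x _ => ?_).trans ?_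
      · simp
      · simpa using hB0
    -- Raising to the `i`-th power turns the frequency `a` into `i * a`, nonzero because `p ∤ i`.
    · have h1 : ∑ x : Fˣ, ψ (a * (x : F) ^ m) ^ i = unitPowSum ψ m (i * a) := by
        refine Finset.sum_congr rfl fun x _ => ?_
        rw [← AddChar.map_nsmul_eq_pow, nsmul_eq_mul, mul_assoc]
      rw [h1, add_zero]
      refine (norm_unitPowSum_le hψ hm (mul_ne_zero ?_ ha)).trans hB
      rwa [Ne, CharP.cast_eq_zero_iff F p]
  rw [← Finset.add_sum_erase _ _ (Finset.mem_univ (0 : F))] at hsum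
  have h2 : ‖e 0‖ ≤ (Fintype.card Fˣ : ℝ) * negBinomCoeff (B + (Fintype.card Fˣ : ℝ) / 3) k := by
    have h3 : e 0 = -∑ a ∈ univ.erase (0 : F), ψ (-(a * b)) * e a := by
      rw [← add_eq_zero_iff_eq_neg]
      simpa using hsum
    rw [h3, norm_neg]
    refine (norm_sum_le_of_le _ (n := fun _ => negBinomCoeff (B + (Fintype.card Fˣ : ℝ) / 3) k)
      fun a ha => ?_).trans ?_
    · rw [norm_mul, AddChar.norm_apply, one_mul]
      exact hea a (Finset.ne_of_mem_erase ha)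
    · rw [Finset.sum_const, nsmul_eq_mul, Finset.card_erase_of_mem (Finset.mem_univ _),
        Finset.card_univ, Fintype.card_units]
  rw [he0, Complex.norm_natCast] at h2
  linarith

lemma Nstar_pos_of_sum_pow_eq {F : Type*} [Field F] [Fintype F] {m k : ℕ} {b : F}
    {t : Finset Fˣ} (ht : #t = k) (hb : ∑ x ∈ t, (x : F) ^ m = b) : 0 < Nstar F m k b := by
  rw [Nstar, Set.ncard_pos (Set.toFinite _)]
  let f := (Finset.equivFinOfCardEq ht).symm
  refine ⟨fun i => ((f i : Fˣ) : F), fun i => Units.ne_zero _, fun i j hij h => ?_, ?_⟩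
  · exact hij (f.injective (Subtype.ext (Units.ext h)))
  · rw [← hb, ← Finset.sum_coe_sort t, Equiv.sum_comp f (fun x : t => ((x : Fˣ) : F) ^ m)]

lemma pow_mul_lt_one_of_six_mul_log_lt {q : ℝ} (hq : 0 < q) {k : ℕ}
    (hk : 6 * Real.log q < k) : (5 / 6 + 1 / 100 : ℝ) ^ k * q < 1 := by
  have h1 : (5 / 6 + 1 / 100 : ℝ) ≤ Real.exp (-(1 / 6)) := by
    rw [Real.exp_neg, le_inv_comm₀ (by norm_num) (Real.exp_pos _)]
    have := Real.exp_bound' (x := 1 / 6) (by norm_num) (by norm_num) (n := 3) (by norm_num)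
    refine this.trans ?_
    norm_num [Finset.sum_range_succ, Nat.factorial]
  calc (5 / 6 + 1 / 100 : ℝ) ^ k * q ≤ Real.exp (-(1 / 6)) ^ k * q := by gcongr
    _ = Real.exp (k * (-(1 / 6)) + Real.log q) := by
        rw [Real.exp_add, Real.exp_log hq, Real.exp_nat_mul]
    _ < 1 := by
        rw [Real.exp_lt_one_iff]
        linarith

theorem mainTheorem4 :
    ∃ c : ℝ, 0 < c ∧ c < 1 ∧ IsEffectivelyComputable c ∧
      ∀ (F : Type*) [Field F] [Fintype F] (p : ℕ) [CharP F p], 2 < p →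
        ∀ m k : ℕ, 0 < m →
          (m : ℝ) < c * Real.sqrt (Fintype.card F : ℝ) →
          6 * Real.log (Fintype.card F : ℝ) < (k : ℝ) →
          (k : ℝ) ≤ ((Fintype.card F : ℝ) - 1) / 2 →
          ∀ b : F, 0 < Nstar F m k b := by
  refine ⟨1 / 200, by norm_num, by norm_num, effectivelyComputable_one_div_200, ?_⟩
  intro F _ _ p _ hp m k hm hmq hkq hk b
  classical
  have hq : (Fintype.card F : ℝ) = Fintype.card Fˣ + 1 := by
    rw [Fintype.card_eq_card_units_add_one (α := F)]
    push_cast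
    rfl
  set q : ℝ := (Fintype.card F : ℝ) with hqdef
  set n : ℕ := Fintype.card Fˣ
  have hm1 : (1 : ℝ) ≤ m := by exact_mod_cast hm
  have hsq : √q * √q = q := Real.mul_self_sqrt (by positivity)
  -- The bound on `m` with `m ≥ 1` already forces `q` to be large.
  have hsqrt : 200 < √q := by linarith
  have hq200 : 200 * 200 < q := by nlinarith
  have hB : m * √q ≤ (n : ℝ) / 100 := by nlinarith
  have hkn : (k : ℝ) ≤ n / 2 := by linarith
  have hkn' : k ≤ n := by exact_mod_cast (show (k : ℝ) ≤ n by linarith)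
  have hchoose : (0 : ℝ) < n.choose k := by exact_mod_cast Nat.choose_pos hkn'
  -- `R` is `1/100 + 1/3` from `M / n`, plus `1/2` from `k / n`.
  have hv := negBinomCoeff_le_pow_mul_choose (M := (n : ℝ) / 100 + n / 3) (R := 5 / 6 + 1 / 100)
    (by positivity) (by norm_num) hkn' (by linarith)
  have hpow := pow_mul_lt_one_of_six_mul_log_lt (by linarith) hkq
  obtain ⟨t, ht, hb⟩ := exists_powersetCard_sum_pow_eq (p := p) (k := k) hp hm hB (by linarith)
    (by
      have hR : (0 : ℝ) < (5 / 6 + 1 / 100) ^ k := by positivity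
      calc (n : ℝ) * negBinomCoeff ((n : ℝ) / 100 + n / 3) k
          ≤ n * ((5 / 6 + 1 / 100) ^ k * n.choose k) := by gcongr
        _ = ((5 / 6 + 1 / 100) ^ k * n) * n.choose k := by ring
        _ < 1 * n.choose k := by
            refine mul_lt_mul_of_pos_right ?_ hchoose
            nlinarith
        _ = _ := one_mul _) b
  exact Nstar_pos_of_sum_pow_eq ht hb
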